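/- **Conventions.** For a finite abelian group $G$, a subset $X\subseteq G$ and a subgroup $H\le G$, let $X/H$ be the image of $X$ in $G/H$. The subgroup of periods of $X$ is $G_X=\{a\in G: X+a=X\}$; $X$ is aperiodic if $G_X=\{0\}$, and $X$ is $H$-periodic if $G_X=H\neq\{0\}$. For $S\subseteq G\setminus\{0\}$ with $S=-S$, $\mathrm{Cay}(G,S)$ is the graph on $G$ in which $x,y$ are adjacent iff $x-y\in S$, and $S_0=S\cup\{0\}$. A perfect code in a graph is a set $D$ of vertices such that every vertex is at distance at most $1$ from exactly one vertex of $D$. A subgroup series $H_0<H_1<\cdots<H_{2t-1}\le H_{2t}=G$ with $t\ge 1$ is an admissible subgroup series of length $2t$ associated with $X$ if either (a) $H_0=\{0\}$, $X$ is aperiodic, and - (T1) $(X/H_{2i}-X/H_{2i})\cap(H_{2i+1}/H_{2i})=\{0\}$ for $0\le i\le t-1$; - (T2) $X/H_{2i-1}$ is $(H_{2i}/H_{2i-1})$-periodic for $1\le i\le t$; - (T3) $|X/H_{2t-1}|=|G/H_{2t-1}|$, and $|X/H_{2i}|=|X/H_{2i+1}|$ for $0\le i\le t-1$; or (b) $H_0\ne\{0\}$,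 $X$ is $H_0$-periodic, and $X/H_0$ satisfies (T1)–(T3) in $G/H_0$ with respect to the series $H_0/H_0<H_1/H_0<\cdots\le H_{2t}/H_0$. The set $X$ is pyramidal if $0\in X$ and it has an associated admissible subgroup series. **Theorem.** Let $n=p^\ell m$, where $p$ is a prime and $\ell\ge1$, $m\ge2$ are integers. Let $\mathrm{Cay}(\mathbb Z_n,S)$ be connected of degree $p^\ell-1$, with $S_0$ pyramidal. Then $S_0$ has associated admissible subgroup series of greatest length. Let $H_0<H_1<\cdots<H_{2t-1}\le H_{2t}=\mathbb Z_n$ be any one of them. Then there are nonnegative integers $h_0,\dots,h_t$ and positive integers $k_0,\dots,k_t$ such that - $H_0=\langle p^{h_0}k_0\rangle$, and $H_{2i-1}=\langle p^{h_{i-1}}k_i\rangle$, $H_{2i}=\langle p^{h_i}k_i\rangle$ for $1\le i\le t$; - $k_0=m$, $k_t=1$, and $k_i\mid k_{i-1}$ for $1\le i\le t$; - $0=h_t<h_{t-1}<\cdots<h_0$, with $h_0=\ell$ if $S_0$ is aperiodic and $h_0<\ell$ if $S_0$ is periodic (i.e. not aperiodic). These conditions determine the two sequences, and the number $c(S)$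 of distinct perfect codes of $\mathrm{Cay}(\mathbb Z_n,S)$ containing $0$ satisfies $$c(S)\ \ge\ p^{\left(\sum_{i=0}^{t-1}(h_{i-1}-h_i)k_i\right)+h_{t-1}-\ell},\qquad\text{where } h_{-1}=\ell.$$ -/

import Mathlib

open scoped Pointwise

/-- A perfect `e`-code: every vertex is at distance at most `e` from exactly one vertex of `D`
(`edist` is the extended distance, `⊤` between different components). -/
def IsPerfectECode {V : Type*} (Γ : SimpleGraph V) (e : ℕ) (D : Set V) : Prop :=
  ∀ v : V, ∃! d : V, d ∈ D ∧ Γ.edist v d ≤ (e : ℕ∞)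

/-- A perfect code is a perfect `1`-code. -/
def IsPerfectCode {V : Type*} (Γ : SimpleGraph V) (D : Set V) : Prop :=
  IsPerfectECode Γ 1 D

/-- The number of perfect codes of `Γ` that contain the vertex `v`. -/
noncomputable def numPerfectCodesContaining {V : Type*} (Γ : SimpleGraph V) (v : V) : ℕ :=
  {D : Set V | IsPerfectCode Γ D ∧ v ∈ D}.ncard

/-- The extended connection set `S₀ = S ∪ {0}`. -/
def extendedConnectionSet {G : Type*} [AddCommGroup G] (S : Set G) : Set G :=
  S ∪ {0}

/-- The subgroup of periods of `X`: all `a` with `a + X = X`. -/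
def periodSubgroup {G : Type*} [AddCommGroup G] (X : Set G) : AddSubgroup G :=
  AddAction.stabilizer G X

/-- `X` is aperiodic: its subgroup of periods is trivial. -/
def IsAperiodic {G : Type*} [AddCommGroup G] (X : Set G) : Prop :=
  periodSubgroup X = ⊥

/-- `X` is `H`-periodic: its subgroup of periods is nontrivial and equal to `H`. -/
def IsPeriodicWith {G : Type*} [AddCommGroup G] (X : Set G) (H : AddSubgroup G) : Prop :=
  periodSubgroup X ≠ ⊥ ∧ periodSubgroup X = H

/-- `X / H`: the image of the subset `X` of `G` in the quotient group `G ⧸ H`. -/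
def quotSet {G : Type*} [AddCommGroup G] (X : Set G) (H : AddSubgroup G) : Set (G ⧸ H) :=
  QuotientAddGroup.mk' H '' X

/-- `K / H`: the image of the subgroup `K` of `G` in the quotient group `G ⧸ H`. -/
def quotSubgroup {G : Type*} [AddCommGroup G] (K H : AddSubgroup G) : AddSubgroup (G ⧸ H) :=
  K.map (QuotientAddGroup.mk' H)

/-- `H 0 < H 1 < ⋯ < H (2t - 1) ≤ H (2t) = G` with `t ≥ 1`
(only the terms of index at most `2t` matter). -/
def IsSubgroupSeries {G : Type*} [AddCommGroup G] (t : ℕ) (H : ℕ → AddSubgroup G) : Prop :=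
  1 ≤ t ∧ (∀ i, i + 1 < 2 * t → H i < H (i + 1)) ∧ H (2 * t - 1) ≤ H (2 * t) ∧ H (2 * t) = ⊤

/-- The conditions (T1), (T2), (T3) on a subset `X` of a finite abelian group `G`
with respect to a subgroup series `H 0, …, H (2t)`. -/
structure PyramidConditions {G : Type*} [AddCommGroup G] (X : Set G) (t : ℕ)
    (H : ℕ → AddSubgroup G) : Prop where
  T1 : ∀ i < t,
    (quotSet X (H (2 * i)) - quotSet X (H (2 * i))) ∩
      (quotSubgroup (H (2 * i + 1)) (H (2 * i)) : Set (G ⧸ H (2 * i))) = {0}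
  T2 : ∀ i, 1 ≤ i → i ≤ t →
    IsPeriodicWith (quotSet X (H (2 * i - 1))) (quotSubgroup (H (2 * i)) (H (2 * i - 1)))
  T3_top : (quotSet X (H (2 * t - 1))).ncard = Nat.card (G ⧸ H (2 * t - 1))
  T3 : ∀ i < t, (quotSet X (H (2 * i))).ncard = (quotSet X (H (2 * i + 1))).ncard

/-- `H 0 < H 1 < ⋯ < H (2t - 1) ≤ H (2t) = G` is an admissible subgroup series of length `2t`
associated with `X`: either `H 0` is trivial, `X` is aperiodic and (T1)-(T3) hold in `G`;
or `H 0` is nontrivial, `X` is `H 0`-periodic and `X / H 0` satisfies (T1)-(T3) in `G ⧸ H 0`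
with respect to the series `H 0 / H 0, H 1 / H 0, …, H (2t) / H 0`. -/
def IsAdmissibleSeries {G : Type*} [AddCommGroup G] (X : Set G) (t : ℕ)
    (H : ℕ → AddSubgroup G) : Prop :=
  IsSubgroupSeries t H ∧
    ((H 0 = ⊥ ∧ IsAperiodic X ∧ PyramidConditions X t H) ∨
      (H 0 ≠ ⊥ ∧ IsPeriodicWith X (H 0) ∧
        PyramidConditions (quotSet X (H 0)) t (fun i => quotSubgroup (H i) (H 0))))

/-- A pyramidal set: contains `0` and has an associated admissible subgroup series. -/
def IsPyramidal {G : Type*} [AddCommGroup G] (X : Set G) : Prop :=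
  0 ∈ X ∧ ∃ (t : ℕ) (H : ℕ → AddSubgroup G), IsAdmissibleSeries X t H

/-- An admissible subgroup series associated with `X` of the greatest possible length `2t`. -/
def IsLongestAdmissibleSeries {G : Type*} [AddCommGroup G] (X : Set G) (t : ℕ)
    (H : ℕ → AddSubgroup G) : Prop :=
  IsAdmissibleSeries X t H ∧
    ∀ (t' : ℕ) (H' : ℕ → AddSubgroup G), IsAdmissibleSeries X t' H' → t' ≤ t

/-- `(h 0, …, h t)` and `(k 0, …, k t)` are the sequences of the series `H 0, …, H (2t)` of
subgroups of `ℤ_n`, where `n = p ^ ℓ * m`. The divisibility and monotonicity clauses make the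
generators `p ^ h i * k i` and `p ^ h (i - 1) * k i` divisors of `n`, so that the values are
determined by the series. -/
structure IsSeqPair {n : ℕ} (p ℓ m : ℕ) (X : Set (ZMod n)) (t : ℕ)
    (H : ℕ → AddSubgroup (ZMod n)) (h k : ℕ → ℕ) : Prop where
  zero : H 0 = AddSubgroup.zmultiples ((p ^ h 0 * k 0 : ℕ) : ZMod n)
  odd : ∀ i, 1 ≤ i → i ≤ t →
    H (2 * i - 1) = AddSubgroup.zmultiples ((p ^ h (i - 1) * k i : ℕ) : ZMod n)
  even : ∀ i, 1 ≤ i → i ≤ t →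
    H (2 * i) = AddSubgroup.zmultiples ((p ^ h i * k i : ℕ) : ZMod n)
  k_zero : k 0 = m
  k_last : k t = 1
  k_dvd : ∀ i, 1 ≤ i → i ≤ t → k i ∣ k (i - 1)
  h_last : h t = 0
  h_lt : ∀ i, 1 ≤ i → i ≤ t → h i < h (i - 1)
  h_zero_aperiodic : IsAperiodic X → h 0 = ℓ
  h_zero_periodic : ¬ IsAperiodic X → h 0 < ℓ

/-- The exponent `∑_{i=0}^{t-1} (h_{i-1} - h_i) k_i + h_{t-1} - ℓ`, where `h_{-1} = ℓ`. -/
def codeExponent (ℓ t : ℕ) (h k : ℕ → ℕ) : ℤ :=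
  (∑ i ∈ Finset.range t,
      ((if i = 0 then (ℓ : ℤ) else (h (i - 1) : ℤ)) - (h i : ℤ)) * (k i : ℤ))
    + (h (t - 1) : ℤ) - (ℓ : ℤ)

/-! A perfect code of the Cayley graph is a tiling complement of `X = S ∪ {0}`, so the task is to
bound below the number of complements through `0`. This is done by descending the series from the
trivial quotient `G / H (2t)`, where a complement exists.

Two kinds of step alternate. If `X/K → X/L` is injective, preimages of complements of `X/L` are
complements of `X/K`, so nothing is lost (`numTilingComplements_image_le`). If `X/K` is a union of
cosets of `L/K`, every point of a complement of `X/L` may be lifted arbitrarily. Keeping `0` over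
`0`, a complement of size `c` has `[L : K] ^ (c - 1)` such lifts
(`numTilingComplements_image_mul_le`). (T1) gives the first kind, (T2) the second, and the periods
of `X` itself give one more of the second kind. The product is `IsPyramidSeries.prod_relIndex_le`.

In `ℤ_n` one has `|X/H (2i)| = p ^ h i`, and `k i` is the size of a complement of `X/H (2i)`. The
factors are then powers of `p` whose exponents telescope to `codeExponent`. -/

section Tilings

/-! ### Tiling complements under homomorphisms. -/

variable {A B : Type*} [AddCommGroup A] [AddCommGroup B]

/-- Every element of `A` is uniquely a sum of an element of `Y` and one of `D`. -/
def IsTilingComplement (Y D : Set A) : Prop :=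
  ∀ g : A, ∃! d : A, d ∈ D ∧ g - d ∈ Y

/-- The number of tiling complements of `Y` that contain `0`. -/
noncomputable def numTilingComplements (Y : Set A) : ℕ :=
  Nat.card {D : Set A // IsTilingComplement Y D ∧ (0 : A) ∈ D}

theorem IsTilingComplement.ncard_mul_ncard [Finite A] {Y D : Set A}
    (h : IsTilingComplement Y D) : Y.ncard * D.ncard = Nat.card A := by
  rw [← Nat.card_coe_set_eq, ← Nat.card_coe_set_eq, ← Nat.card_prod]
  refine Nat.card_congr (Equiv.ofBijective (fun q : Y × D => (q.1 : A) + q.2) ⟨?_, ?_⟩)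
  · rintro ⟨⟨y, hy⟩, ⟨d, hd⟩⟩ ⟨⟨y', hy'⟩, ⟨d', hd'⟩⟩ hq
    simp only at hq
    have hdd : d = d' := (h (y + d)).unique ⟨hd, by simpa using hy⟩
      ⟨hd', by rw [hq]; simpa using hy'⟩
    subst hdd
    simpa using hq
  · intro g
    obtain ⟨d, ⟨hd, hgd⟩, -⟩ := h g
    exact ⟨(⟨g - d, hgd⟩, ⟨d, hd⟩), by simp⟩

/-- Over the unique `d` for `f g` there is a single `y ∈ Y` with `f y = f g - d`, by injectivity;
this forces the summand `g - y`. -/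
theorem IsTilingComplement.preimage {f : A →+ B} {Y : Set A} (hY : Set.InjOn f Y) {D : Set B}
    (hD : IsTilingComplement (f '' Y) D) : IsTilingComplement Y (f ⁻¹' D) := by
  intro g
  obtain ⟨d, ⟨hd, y, hy, hyd⟩, huniq⟩ := hD (f g)
  have hfd : f (g - y) = d := by simp [hyd]
  refine ⟨g - y, ⟨by simpa [hyd] using hd, by simpa using hy⟩, ?_⟩
  rintro e ⟨he, hge⟩
  have hfe : f e = d := huniq (f e) ⟨he, g - e, hge, by simp⟩
  have : g - e = y := hY hge hy (by simp [hfe, hyd])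
  rw [← this]; abel

theorem numTilingComplements_image_le [Finite A] {f : A →+ B} (hf : Function.Surjective f)
    {Y : Set A} (hY : Set.InjOn f Y) :
    numTilingComplements (f '' Y) ≤ numTilingComplements Y := by
  refine Nat.card_le_card_of_injective
    (fun D => ⟨f ⁻¹' D.1, D.2.1.preimage hY, by simpa using D.2.2⟩) ?_
  rintro ⟨D, hD⟩ ⟨D', hD'⟩ h
  exact Subtype.ext (hf.preimage_injective (congrArg Subtype.val h))

/-- As `Y` is a union of cosets of the kernel, whether `g - τ d` lies in `Y` depends only on `f g -
d`, so any choice of lifts works. -/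
theorem IsTilingComplement.image_section {f : A →+ B} {Y : Set A}
    (hY : ∀ y ∈ Y, ∀ a, f a = 0 → y + a ∈ Y) {D : Set B} (hD : IsTilingComplement (f '' Y) D)
    {τ : B → A} (hτ : ∀ d ∈ D, f (τ d) = d) : IsTilingComplement Y (τ '' D) := by
  intro g
  obtain ⟨d, ⟨hd, y, hy, hyd⟩, huniq⟩ := hD (f g)
  refine ⟨τ d, ⟨⟨d, hd, rfl⟩, ?_⟩, ?_⟩
  · have := hY y hy (g - τ d - y) (by simp [hτ d hd, hyd])
    simpa using this
  · rintro _ ⟨⟨d', hd', rfl⟩, he⟩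
    rw [huniq d' ⟨hd', g - τ d', he, by simp [hτ d' hd']⟩]

-- All complements of `f '' Y` have the same size `c`, so each has the same number of lifts through
-- `0`.
open Classical in
theorem numTilingComplements_image_mul_le [Finite A] {f : A →+ B}
    (hf : Function.Surjective f) {Y : Set A} (hY : ∀ y ∈ Y, ∀ a, f a = 0 → y + a ∈ Y) {c : ℕ}
    (hpos : 0 < (f '' Y).ncard) (hc : (f '' Y).ncard * c = Nat.card B) :
    numTilingComplements (f '' Y) * Nat.card f.ker ^ (c - 1) ≤ numTilingComplements Y := by
  have : Finite B := Finite.of_surjective f hf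
  obtain ⟨s, hs⟩ := hf.hasRightInverse
  -- The point `0` is lifted to `0`, so only the other `c - 1` points carry a free kernel element
  -- `σ`.
  let τ : (D : Set B) → (↥(D \ {0}) → f.ker) → B → A := fun D σ b =>
    if h : b ∈ D \ {0} then s b + σ ⟨b, h⟩ else 0
  have hτ : ∀ D σ, ∀ d ∈ D, f (τ D σ d) = d := by
    intro D σ d hd
    by_cases h0 : d = 0
    · simp [τ, h0]
    · have h : d ∈ D \ {0} := ⟨hd, h0⟩
      have hk : f (σ ⟨d, h⟩ : A) = 0 := (σ ⟨d, h⟩).2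
      simp only [τ, h, dite_true, map_add, hs d, hk, add_zero]
  have himage : ∀ D σ, f '' (τ D σ '' D) = D := by
    intro D σ
    rw [Set.image_image]
    exact (Set.image_congr (hτ D σ)).trans (Set.image_id' D)
  let Φ : (Σ D : {D : Set B // IsTilingComplement (f '' Y) D ∧ (0 : B) ∈ D},
      (↥(D.1 \ {0}) → f.ker)) → {D : Set A // IsTilingComplement Y D ∧ (0 : A) ∈ D} :=
    fun q => ⟨τ q.1.1 q.2 '' q.1.1, q.1.2.1.image_section hY (hτ q.1.1 q.2),
      0, q.1.2.2, by simp [τ]⟩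
  -- Applying `f` to a lifted set recovers `D`; the lift over each point then recovers `σ`.
  have hΦ : Function.Injective Φ := by
    rintro ⟨⟨D, hD⟩, σ⟩ ⟨⟨D', hD'⟩, σ'⟩ h
    have h' : τ D σ '' D = τ D' σ' '' D' := congrArg Subtype.val h
    have hDD : D = D' := by rw [← himage D σ, h', himage]
    subst hDD
    congr 1
    funext ⟨d, hd⟩
    have hmem : τ D σ d ∈ τ D σ' '' D := h' ▸ ⟨d, hd.1, rfl⟩
    obtain ⟨e, he, hed⟩ := hmem
    have : e = d := by rw [← hτ D σ' e he, hed, hτ D σ d hd.1]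
    subst this
    simp only [τ, hd, dite_true, add_right_inj] at hed
    exact Subtype.ext hed.symm
  have hcard := Nat.card_le_card_of_injective Φ hΦ
  have : Fintype {D : Set B // IsTilingComplement (f '' Y) D ∧ (0 : B) ∈ D} := Fintype.ofFinite _
  rw [Nat.card_sigma] at hcard
  refine le_trans (le_of_eq ?_) hcard
  rw [Finset.sum_congr rfl (g := fun _ => Nat.card f.ker ^ (c - 1))]
  · simp [numTilingComplements]
  · rintro ⟨D, hD, h0⟩ -
    have hDc : D.ncard = c :=
      Nat.eq_of_mul_eq_mul_left hpos (hD.ncard_mul_ncard.trans hc.symm)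
    rw [Nat.card_fun, Nat.card_coe_set_eq, Set.ncard_sdiff_singleton_of_mem h0, hDc]

theorem ncard_eq_ncard_image_mul_card_ker [Finite A] {f : A →+ B} {Y : Set A}
    (hY : ∀ y ∈ Y, ∀ a, f a = 0 → y + a ∈ Y) :
    Y.ncard = (f '' Y).ncard * Nat.card f.ker := by
  rw [← Nat.card_coe_set_eq, ← Nat.card_coe_set_eq, ← Nat.card_prod]
  have hs : ∀ b : f '' Y, ∃ y ∈ Y, f y = b := fun b => b.2
  choose s hsY hsf using hs
  refine (Nat.card_congr (Equiv.ofBijective (fun q : (f '' Y) × f.ker =>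
    (⟨s q.1 + q.2, hY _ (hsY _) _ q.2.2⟩ : Y)) ⟨?_, ?_⟩)).symm
  · rintro ⟨b, a, ha⟩ ⟨b', a', ha'⟩ h
    have h' : s b + a = s b' + a' := congrArg Subtype.val h
    rw [AddMonoidHom.mem_ker] at ha ha'
    have hb : b = b' := by
      have := congrArg f h'
      simp only [map_add, hsf, ha, ha', add_zero] at this
      exact Subtype.ext this
    subst hb
    simpa using h'
  · rintro ⟨y, hy⟩
    refine ⟨(⟨f y, y, hy, rfl⟩, ⟨y - s ⟨f y, y, hy, rfl⟩, ?_⟩), ?_⟩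
    · simp [AddMonoidHom.mem_ker, hsf]
    · simp

end Tilings

/-! ### Passing between the quotients by nested subgroups. -/

section Quotients

variable {G : Type*} [AddCommGroup G]

/-- The projection `G ⧸ K → G ⧸ L` for `K ≤ L`. -/
def quotientProjection {K L : AddSubgroup G} (h : K ≤ L) : G ⧸ K →+ G ⧸ L :=
  QuotientAddGroup.map K L (AddMonoidHom.id G) h

theorem quotientProjection_mk {K L : AddSubgroup G} (h : K ≤ L) (x : G) :
    quotientProjection h (QuotientAddGroup.mk' K x) = QuotientAddGroup.mk' L x := rfl

theorem quotientProjection_surjective {K L : AddSubgroup G} (h : K ≤ L) :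
    Function.Surjective (quotientProjection h) := by
  intro b
  obtain ⟨x, rfl⟩ := QuotientAddGroup.mk'_surjective L b
  exact ⟨QuotientAddGroup.mk' K x, rfl⟩

theorem image_quotientProjection {K L : AddSubgroup G} (h : K ≤ L) (X : Set G) :
    quotientProjection h '' quotSet X K = quotSet X L := by
  rw [quotSet, Set.image_image]
  rfl

theorem mk'_eq_mk'_iff {K : AddSubgroup G} {x y : G} :
    QuotientAddGroup.mk' K x = QuotientAddGroup.mk' K y ↔ x - y ∈ K := by
  rw [← sub_eq_zero, ← map_sub, QuotientAddGroup.mk'_apply, QuotientAddGroup.eq_zero_iff]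

theorem card_ker_quotientProjection [Finite G] {K L : AddSubgroup G} (h : K ≤ L) :
    Nat.card (quotientProjection h).ker = K.relIndex L := by
  have h1 : (quotientProjection h).ker.index = L.index := by
    rw [AddSubgroup.index_ker, AddMonoidHom.range_eq_top.2 (quotientProjection_surjective h),
      AddSubgroup.card_top]
    rfl
  have h2 := AddSubgroup.card_mul_index (quotientProjection h).ker
  rw [h1] at h2
  have h3 : Nat.card (G ⧸ K) = K.relIndex L * L.index := (AddSubgroup.relIndex_mul_index h).symm
  exact Nat.eq_of_mul_eq_mul_right (Nat.pos_of_ne_zero AddSubgroup.index_ne_zero_of_finite)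
    (h2.trans h3)

theorem mk'_mem_quotSubgroup_iff {K H : AddSubgroup G} (h : H ≤ K) {x : G} :
    QuotientAddGroup.mk' H x ∈ quotSubgroup K H ↔ x ∈ K := by
  refine ⟨?_, fun hx => ⟨x, hx, rfl⟩⟩
  rintro ⟨y, hy, hyx⟩
  have := K.sub_mem hy (h (mk'_eq_mk'_iff.1 hyx))
  simpa using this

theorem quotSubgroup_mono {K L H : AddSubgroup G} (h : K ≤ L) :
    quotSubgroup K H ≤ quotSubgroup L H :=
  AddSubgroup.map_mono h

/-- Distinct cosets of `K` that meet `X` lie in distinct cosets of `L`. -/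
def QuotInjective (X : Set G) (K L : AddSubgroup G) : Prop :=
  ∀ x ∈ X, ∀ y ∈ X, x - y ∈ L → x - y ∈ K

/-- The set `X + K` is stable under translation by `L`. -/
def QuotSaturated (X : Set G) (K L : AddSubgroup G) : Prop :=
  ∀ x ∈ X, ∀ a ∈ L, ∃ y ∈ X, x + a - y ∈ K

theorem quotInjective_of_inter_eq {X : Set G} {K L : AddSubgroup G}
    (h : (quotSet X K - quotSet X K) ∩ (quotSubgroup L K : Set (G ⧸ K)) = {0}) :
    QuotInjective X K L := by
  intro x hx y hy hxy
  have hmem : QuotientAddGroup.mk' K (x - y) ∈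
      (quotSet X K - quotSet X K) ∩ (quotSubgroup L K : Set (G ⧸ K)) :=
    ⟨by rw [map_sub]; exact Set.sub_mem_sub ⟨x, hx, rfl⟩ ⟨y, hy, rfl⟩, x - y, hxy, rfl⟩
  rw [h, Set.mem_singleton_iff, QuotientAddGroup.mk'_apply, QuotientAddGroup.eq_zero_iff] at hmem
  exact hmem

theorem quotSaturated_of_isPeriodicWith {X : Set G} {K L : AddSubgroup G}
    (h : IsPeriodicWith (quotSet X K) (quotSubgroup L K)) : QuotSaturated X K L := by
  intro x hx a ha
  have hper : QuotientAddGroup.mk' K a ∈ periodSubgroup (quotSet X K) := by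
    rw [h.2]; exact ⟨a, ha, rfl⟩
  have hstab : QuotientAddGroup.mk' K a +ᵥ quotSet X K = quotSet X K := hper
  have hmem : QuotientAddGroup.mk' K a +ᵥ QuotientAddGroup.mk' K x ∈ quotSet X K := by
    rw [← hstab]
    exact Set.vadd_mem_vadd_set ⟨x, hx, rfl⟩
  obtain ⟨y, hy, hyx⟩ := hmem
  refine ⟨y, hy, mk'_eq_mk'_iff.1 ?_⟩
  rw [hyx, map_add, vadd_eq_add, add_comm]

/-- Periodicity includes a nontrivial period group; this makes even the last inclusion of the series
strict. -/
theorem not_le_of_isPeriodicWith {X : Set G} {K L : AddSubgroup G}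
    (h : IsPeriodicWith (quotSet X K) (quotSubgroup L K)) : ¬ L ≤ K := by
  intro hLK
  apply h.1
  rw [h.2, eq_bot_iff]
  rintro _ ⟨x, hx, rfl⟩
  exact (QuotientAddGroup.eq_zero_iff x).2 (hLK hx)

/-- Phrased by membership in subgroups of `G`, the condition pulls back from `G ⧸ H` without
identifying iterated quotients. -/
theorem QuotInjective.of_quotSet {X : Set G} {H K L : AddSubgroup G} (hK : H ≤ K)
    (h : QuotInjective (quotSet X H) (quotSubgroup K H) (quotSubgroup L H)) :
    QuotInjective X K L := by
  intro x hx y hy hxy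
  have := h _ ⟨x, hx, rfl⟩ _ ⟨y, hy, rfl⟩ (by rw [← map_sub]; exact ⟨x - y, hxy, rfl⟩)
  rwa [← map_sub, mk'_mem_quotSubgroup_iff hK] at this

theorem QuotSaturated.of_quotSet {X : Set G} {H K L : AddSubgroup G} (hK : H ≤ K)
    (h : QuotSaturated (quotSet X H) (quotSubgroup K H) (quotSubgroup L H)) :
    QuotSaturated X K L := by
  intro x hx a ha
  obtain ⟨_, ⟨y, hy, rfl⟩, hyx⟩ := h _ ⟨x, hx, rfl⟩ _ ⟨a, ha, rfl⟩
  refine ⟨y, hy, ?_⟩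
  rwa [← map_add, ← map_sub, mk'_mem_quotSubgroup_iff hK] at hyx

theorem QuotInjective.injOn {X : Set G} {K L : AddSubgroup G} (hKL : K ≤ L)
    (h : QuotInjective X K L) : Set.InjOn (quotientProjection hKL) (quotSet X K) := by
  rintro _ ⟨x, hx, rfl⟩ _ ⟨y, hy, rfl⟩ hxy
  rw [quotientProjection_mk, quotientProjection_mk, mk'_eq_mk'_iff] at hxy
  exact mk'_eq_mk'_iff.2 (h x hx y hy hxy)

theorem QuotSaturated.add_mem {X : Set G} {K L : AddSubgroup G} (hKL : K ≤ L)
    (h : QuotSaturated X K L) :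
    ∀ y ∈ quotSet X K, ∀ a, quotientProjection hKL a = 0 → y + a ∈ quotSet X K := by
  rintro _ ⟨x, hx, rfl⟩ a ha
  obtain ⟨a, rfl⟩ := QuotientAddGroup.mk'_surjective K a
  rw [quotientProjection_mk, QuotientAddGroup.mk'_apply, QuotientAddGroup.eq_zero_iff] at ha
  obtain ⟨y, hy, hyx⟩ := h x hx a ha
  exact ⟨y, hy, by rw [← map_add]; exact (mk'_eq_mk'_iff.2 hyx).symm⟩

variable {X : Set G} {K L : AddSubgroup G}

theorem QuotInjective.ncard_eq (hKL : K ≤ L) (h : QuotInjective X K L) :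
    (quotSet X K).ncard = (quotSet X L).ncard := by
  rw [← image_quotientProjection hKL, (h.injOn hKL).ncard_image]

theorem QuotSaturated.ncard_eq [Finite G] (hKL : K ≤ L) (h : QuotSaturated X K L) :
    (quotSet X K).ncard = (quotSet X L).ncard * K.relIndex L := by
  rw [ncard_eq_ncard_image_mul_card_ker (h.add_mem hKL), image_quotientProjection,
    card_ker_quotientProjection]

theorem QuotInjective.numTilingComplements_le [Finite G] (hKL : K ≤ L) (h : QuotInjective X K L) :
    numTilingComplements (quotSet X L) ≤ numTilingComplements (quotSet X K) := by
  rw [← image_quotientProjection hKL]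
  exact numTilingComplements_image_le (quotientProjection_surjective hKL) (h.injOn hKL)

theorem QuotSaturated.numTilingComplements_mul_le [Finite G] (hKL : K ≤ L)
    (h : QuotSaturated X K L) {c : ℕ}
    (hpos : 0 < (quotSet X L).ncard) (hc : (quotSet X L).ncard * c = L.index) :
    numTilingComplements (quotSet X L) * K.relIndex L ^ (c - 1) ≤
      numTilingComplements (quotSet X K) := by
  have := numTilingComplements_image_mul_le (quotientProjection_surjective hKL)
    (h.add_mem hKL) (c := c) (by rwa [image_quotientProjection])
    (by rw [image_quotientProjection]; exact hc)
  rwa [image_quotientProjection, card_ker_quotientProjection] at this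

end Quotients

/-! ### Admissible series and the product bound. -/

section Series

variable {G : Type*} [AddCommGroup G]

/-- The consequences of the pyramid conditions, expressed in `G` itself, for a series of `2t + 1`
subgroups of `G` that begins with a group of periods of `X`. -/
structure IsPyramidSeries (X : Set G) (t : ℕ) (H : ℕ → AddSubgroup G) : Prop where
  pos : 1 ≤ t
  le : ∀ i < 2 * t, H i ≤ H (i + 1)
  top : H (2 * t) = ⊤
  bottom : QuotSaturated X ⊥ (H 0)
  inj : ∀ i < t, QuotInjective X (H (2 * i)) (H (2 * i + 1))
  sat : ∀ i < t, QuotSaturated X (H (2 * i + 1)) (H (2 * i + 2))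
  lt : ∀ i < t, H (2 * i + 1) < H (2 * i + 2)

theorem IsSubgroupSeries.le_succ {t : ℕ} {H : ℕ → AddSubgroup G} (h : IsSubgroupSeries t H) :
    ∀ i < 2 * t, H i ≤ H (i + 1) := by
  obtain ⟨ht, hlt, hle, -⟩ := h
  intro i hi
  rcases Nat.lt_or_ge (i + 1) (2 * t) with h | h
  · exact (hlt i h).le
  · obtain rfl : i = 2 * t - 1 := by omega
    rwa [show 2 * t - 1 + 1 = 2 * t by omega]

theorem quotSaturated_bot_periodSubgroup (X : Set G) :
    QuotSaturated X ⊥ (periodSubgroup X) := by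
  intro x hx a ha
  have hstab : a +ᵥ X = X := ha
  refine ⟨x + a, ?_, by simp⟩
  rw [← hstab, add_comm]
  exact Set.vadd_mem_vadd_set hx

theorem IsAdmissibleSeries.period_eq {X : Set G} {t : ℕ} {H : ℕ → AddSubgroup G}
    (h : IsAdmissibleSeries X t H) : periodSubgroup X = H 0 := by
  rcases h.2 with ⟨h0, hX, -⟩ | ⟨-, hX, -⟩
  · rw [h0]; exact hX
  · exact hX.2

theorem PyramidConditions.inj {X : Set G} {t : ℕ} {H : ℕ → AddSubgroup G}
    (h : PyramidConditions X t H) :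
    ∀ i < t, QuotInjective X (H (2 * i)) (H (2 * i + 1)) :=
  fun i hi => quotInjective_of_inter_eq (h.T1 i hi)

theorem PyramidConditions.isPeriodicWith {X : Set G} {t : ℕ} {H : ℕ → AddSubgroup G}
    (h : PyramidConditions X t H) :
    ∀ i < t, IsPeriodicWith (quotSet X (H (2 * i + 1)))
      (quotSubgroup (H (2 * i + 2)) (H (2 * i + 1))) :=
  fun i hi => h.T2 (i + 1) (by omega) hi

/-- Merges the aperiodic and periodic cases: in both, `H 0` is the period group of `X`. -/
theorem IsAdmissibleSeries.isPyramidSeries {X : Set G} {t : ℕ} {H : ℕ → AddSubgroup G}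
    (h : IsAdmissibleSeries X t H) : IsPyramidSeries X t H := by
  have hle := h.1.le_succ
  have hH0 : ∀ i ≤ 2 * t, H 0 ≤ H i := by
    intro i
    induction i with
    | zero => intro _; exact le_rfl
    | succ i ih => intro hi; exact (ih (by omega)).trans (hle i (by omega))
  have hmain : (∀ i < t, QuotInjective X (H (2 * i)) (H (2 * i + 1))) ∧
      (∀ i < t, QuotSaturated X (H (2 * i + 1)) (H (2 * i + 2))) ∧
      ∀ i < t, ¬ H (2 * i + 2) ≤ H (2 * i + 1) := by
    rcases h.2 with ⟨-, -, hP⟩ | ⟨-, -, hP⟩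
    · exact ⟨hP.inj, fun i hi => quotSaturated_of_isPeriodicWith (hP.isPeriodicWith i hi),
        fun i hi => not_le_of_isPeriodicWith (hP.isPeriodicWith i hi)⟩
    · exact ⟨fun i hi => (hP.inj i hi).of_quotSet (hH0 _ (by omega)),
        fun i hi => (quotSaturated_of_isPeriodicWith (hP.isPeriodicWith i hi)).of_quotSet
          (hH0 _ (by omega)),
        fun i hi hle' => not_le_of_isPeriodicWith (hP.isPeriodicWith i hi)
          (quotSubgroup_mono hle')⟩
  exact
    { pos := h.1.1
      le := hle
      top := h.1.2.2.2
      bottom := h.period_eq ▸ quotSaturated_bot_periodSubgroup X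
      inj := hmain.1
      sat := hmain.2.1
      lt := fun i hi => lt_of_le_not_ge (hle _ (by omega)) (hmain.2.2 i hi) }

theorem IsSubgroupSeries.length_le [Finite G] {t : ℕ} {H : ℕ → AddSubgroup G}
    (h : IsSubgroupSeries t H) : t ≤ Nat.card G := by
  -- Orders grow strictly only up to index `2t - 1`, since the last inclusion may be an equality
  -- here.
  have hcard : ∀ i, i < 2 * t → i < Nat.card (H i) := by
    intro i
    induction i with
    | zero => intro _; exact Nat.card_pos
    | succ i ih =>
      intro hi
      have h1 := ih (by omega)
      have h2 : Nat.card (H i) < Nat.card (H (i + 1)) := by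
        rw [← SetLike.coe_sort_coe, ← SetLike.coe_sort_coe, Nat.card_coe_set_eq,
          Nat.card_coe_set_eq]
        exact Set.ncard_lt_ncard (h.2.1 i hi)
      omega
  have ht := h.1
  have h1 := hcard (2 * t - 1) (by omega)
  have h2 := AddSubgroup.card_le_card_addGroup (H (2 * t - 1))
  omega

theorem exists_isLongestAdmissibleSeries [Finite G] {X : Set G} (h : IsPyramidal X) :
    ∃ (t : ℕ) (H : ℕ → AddSubgroup G), IsLongestAdmissibleSeries X t H := by
  classical
  let P : ℕ → Prop := fun t => ∃ H : ℕ → AddSubgroup G, IsAdmissibleSeries X t H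
  obtain ⟨-, t, hP⟩ := h
  have hle : ∀ t, P t → t ≤ Nat.card G := fun t ⟨H, hH⟩ => hH.1.length_le
  obtain ⟨H, hH⟩ := Nat.findGreatest_spec (P := P) (hle t hP) hP
  exact ⟨_, H, hH, fun t' H' hH' => Nat.le_findGreatest (hle t' ⟨H', hH'⟩) ⟨H', hH'⟩⟩

namespace IsPyramidSeries

variable {X : Set G} {t : ℕ} {H : ℕ → AddSubgroup G}

theorem ncard_quotSet_succ [Finite G] (h : IsPyramidSeries X t H) {i : ℕ} (hi : i < t) :
    (quotSet X (H (2 * i))).ncard =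
      (quotSet X (H (2 * (i + 1)))).ncard * (H (2 * i + 1)).relIndex (H (2 * (i + 1))) :=
  ((h.inj i hi).ncard_eq (h.le _ (by omega))).trans
    ((h.sat i hi).ncard_eq (h.le _ (by omega)))

theorem ncard_quotSet_last (h : IsPyramidSeries X t H) (hX : X.Nonempty) :
    (quotSet X (H (2 * t))).ncard = 1 := by
  have : Subsingleton (G ⧸ H (2 * t)) := by
    rw [h.top]; exact QuotientAddGroup.subsingleton_quotient_top
  obtain ⟨x, hx⟩ := hX
  exact Set.ncard_eq_one.2 ⟨_, Set.eq_singleton_iff_unique_mem.2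
    ⟨⟨x, hx, rfl⟩, fun _ _ => Subsingleton.elim _ _⟩⟩

theorem ncard_quotSet_zero [Finite G] (h : IsPyramidSeries X t H) :
    X.ncard = (quotSet X (H 0)).ncard * Nat.card (H 0) := by
  have h1 := h.bottom.ncard_eq bot_le
  rwa [AddSubgroup.relIndex_bot_left, quotSet, Set.ncard_image_of_injective] at h1
  intro x y hxy
  simpa [sub_eq_zero] using mk'_eq_mk'_iff.1 hxy

/-- Going down from the top, a periodic step multiplies size and index by the same factor, while an
injective step multiplies only the index. -/
theorem ncard_quotSet_dvd_index [Finite G] (h : IsPyramidSeries X t H) (hX : X.Nonempty) :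
    ∀ i ≤ t, (quotSet X (H (2 * i))).ncard ∣ (H (2 * i)).index := by
  intro i hi
  induction hi using Nat.decreasingInduction with
  | self => rw [h.ncard_quotSet_last hX]; exact one_dvd _
  | of_succ i hi ih =>
    rw [h.ncard_quotSet_succ hi, ← AddSubgroup.relIndex_mul_index (h.le (2 * i) (by omega)),
      ← AddSubgroup.relIndex_mul_index (h.le (2 * i + 1) (by omega)), mul_comm (Set.ncard _)]
    exact Dvd.dvd.mul_left (mul_dvd_mul_left _ ih) _

theorem ncard_quotSet_dvd_ncard [Finite G] (h : IsPyramidSeries X t H) :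
    ∀ i ≤ t, (quotSet X (H (2 * i))).ncard ∣ X.ncard := by
  intro i hi
  induction i with
  | zero => exact ⟨_, h.ncard_quotSet_zero⟩
  | succ i ih => exact Dvd.dvd.trans ⟨_, h.ncard_quotSet_succ hi⟩ (ih (by omega))

theorem numTilingComplements_last_pos [Finite G] (h : IsPyramidSeries X t H) (hX : X.Nonempty) :
    1 ≤ numTilingComplements (quotSet X (H (2 * t))) := by
  have : Subsingleton (G ⧸ H (2 * t)) := by
    rw [h.top]; exact QuotientAddGroup.subsingleton_quotient_top
  obtain ⟨x, hx⟩ := hX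
  have : Nonempty {D : Set (G ⧸ H (2 * t)) //
      IsTilingComplement (quotSet X (H (2 * t))) D ∧ (0 : G ⧸ H (2 * t)) ∈ D} :=
    ⟨⟨Set.univ, fun g => ⟨g, ⟨trivial, x, hx, Subsingleton.elim _ _⟩,
      fun _ _ => Subsingleton.elim _ _⟩, trivial⟩⟩
  exact Nat.card_pos

theorem numTilingComplements_succ [Finite G] (h : IsPyramidSeries X t H) (hX : X.Nonempty) {i : ℕ}
    (hi : i < t) {c : ℕ}
    (hc : (quotSet X (H (2 * (i + 1)))).ncard * c = (H (2 * (i + 1))).index) :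
    numTilingComplements (quotSet X (H (2 * (i + 1)))) *
      (H (2 * i + 1)).relIndex (H (2 * (i + 1))) ^ (c - 1) ≤
      numTilingComplements (quotSet X (H (2 * i))) :=
  ((h.sat i hi).numTilingComplements_mul_le (h.le _ (by omega))
    ((Set.ncard_pos (Set.toFinite _)).2 (hX.image _)) hc).trans
    ((h.inj i hi).numTilingComplements_le (h.le _ (by omega)))

/-- The step from `H 0` to the trivial subgroup; its factor is `1` when `H 0` is trivial. -/
theorem numTilingComplements_zero [Finite G] (h : IsPyramidSeries X t H) (hX : X.Nonempty) {c : ℕ}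
    (hc : (quotSet X (H 0)).ncard * c = (H 0).index) :
    numTilingComplements (quotSet X (H 0)) * Nat.card (H 0) ^ (c - 1) ≤
      numTilingComplements X := by
  have h1 := h.bottom.numTilingComplements_mul_le bot_le
    ((Set.ncard_pos (Set.toFinite _)).2 (hX.image _)) hc
  rw [AddSubgroup.relIndex_bot_left] at h1
  refine h1.trans ?_
  let e : G →+ G ⧸ (⊥ : AddSubgroup G) := QuotientAddGroup.mk' ⊥
  refine numTilingComplements_image_le (f := e) (QuotientAddGroup.mk'_surjective ⊥) ?_
  intro x _ y _ hxy
  simpa [sub_eq_zero] using mk'_eq_mk'_iff.1 hxy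

/-- A product formula for the number of tiling complements of a pyramidal set. -/
theorem prod_relIndex_le [Finite G] (h : IsPyramidSeries X t H) (hX : X.Nonempty) {k : ℕ → ℕ}
    (hk : ∀ i ≤ t, (quotSet X (H (2 * i))).ncard * k i = (H (2 * i)).index) :
    Nat.card (H 0) ^ (k 0 - 1) *
      ∏ i ∈ Finset.range t, (H (2 * i + 1)).relIndex (H (2 * (i + 1))) ^ (k (i + 1) - 1) ≤
      numTilingComplements X := by
  have key : ∀ j ≤ t, numTilingComplements (quotSet X (H (2 * j))) *
      ∏ i ∈ Finset.range j, (H (2 * i + 1)).relIndex (H (2 * (i + 1))) ^ (k (i + 1) - 1) ≤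
      numTilingComplements (quotSet X (H 0)) := by
    intro j hj
    induction j with
    | zero => simp
    | succ j ih =>
      rw [Finset.prod_range_succ, mul_left_comm, mul_comm]
      refine le_trans ?_ (ih (by omega))
      exact Nat.mul_le_mul_right _ (h.numTilingComplements_succ hX hj (hk _ hj))
  have h1 := key t le_rfl
  have h2 := Nat.mul_le_mul_right (∏ i ∈ Finset.range t,
    (H (2 * i + 1)).relIndex (H (2 * (i + 1))) ^ (k (i + 1) - 1))
    (h.numTilingComplements_last_pos hX)
  rw [one_mul] at h2
  have h3 := h.numTilingComplements_zero hX (hk 0 (Nat.zero_le _))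
  rw [mul_comm] at h3
  exact (Nat.mul_le_mul_left _ (h2.trans h1)).trans h3

end IsPyramidSeries

end Series

/-! ### Subgroups of `ℤ_n`, the two sequences and the exponent. -/

section Cyclic

variable {n : ℕ}

theorem index_zmultiples_natCast [NeZero n] {d : ℕ} (hd : d ∣ n) :
    (AddSubgroup.zmultiples (d : ZMod n)).index = d := by
  have h1 := AddSubgroup.card_mul_index (AddSubgroup.zmultiples (d : ZMod n))
  rw [Nat.card_zmultiples, ZMod.addOrderOf_coe d (NeZero.ne n), Nat.gcd_eq_right hd,
    Nat.card_zmod] at h1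
  have hpos : 0 < n / d :=
    Nat.div_pos (Nat.le_of_dvd (NeZero.pos n) hd) (Nat.pos_of_dvd_of_pos hd (NeZero.pos n))
  exact Nat.eq_of_mul_eq_mul_left hpos (h1.trans (Nat.div_mul_cancel hd).symm)

/-- The index annihilates the quotient, so it lies in `K`, and it generates a subgroup of the same
index. Formulas for generators thus reduce to indices. -/
theorem eq_zmultiples_index [NeZero n] (K : AddSubgroup (ZMod n)) :
    K = AddSubgroup.zmultiples (K.index : ZMod n) := by
  have hdvd : K.index ∣ n := by simpa using K.index_dvd_card
  have hle : AddSubgroup.zmultiples (K.index : ZMod n) ≤ K := by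
    rw [AddSubgroup.zmultiples_le, ← nsmul_one]
    exact K.nsmul_index_mem 1
  have h1 := AddSubgroup.relIndex_mul_index hle
  rw [index_zmultiples_natCast hdvd] at h1
  have hrel : (AddSubgroup.zmultiples (K.index : ZMod n)).relIndex K = 1 :=
    Nat.eq_of_mul_eq_mul_right (Nat.pos_of_dvd_of_pos hdvd (NeZero.pos n))
      (h1.trans (one_mul _).symm)
  exact le_antisymm (AddSubgroup.relIndex_eq_one.1 hrel) hle

theorem isAperiodic_iff_card_eq_one {G : Type*} [AddCommGroup G] [Finite G] {X : Set G}
    {K : AddSubgroup G} (h : periodSubgroup X = K) : IsAperiodic X ↔ Nat.card K = 1 := by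
  rw [IsAperiodic, h, AddSubgroup.card_eq_one]

/-- `|X/H (2i)|` divides `p ^ ℓ`, which defines `h i`; `k i` is the cofactor in the index of `H
(2i)`. -/
theorem exists_isSeqPair [NeZero n] {p ℓ m t : ℕ} (hp : p.Prime) (hn : n = p ^ ℓ * m)
    {X : Set (ZMod n)} (hcard : X.ncard = p ^ ℓ) {H : ℕ → AddSubgroup (ZMod n)}
    (hper : periodSubgroup X = H 0) (hH : IsPyramidSeries X t H) :
    ∃ h k : ℕ → ℕ, IsSeqPair p ℓ m X t H h k := by
  have hX : X.Nonempty := by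
    rw [← Set.ncard_pos, hcard]; exact pow_pos hp.pos ℓ
  -- Quantified over all `i`, with junk values past `t`, so that `choose` yields total functions.
  have hN : ∀ i, ∃ a, i ≤ t → (quotSet X (H (2 * i))).ncard = p ^ a := by
    intro i
    by_cases hi : i ≤ t
    · have := hH.ncard_quotSet_dvd_ncard i hi
      rw [hcard, Nat.dvd_prime_pow hp] at this
      exact this.imp fun a ha _ => ha.2
    · exact ⟨0, fun h => absurd h hi⟩
  choose h hh using hN
  have hK : ∀ i, ∃ b, i ≤ t → (H (2 * i)).index = p ^ h i * b := by
    intro i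
    by_cases hi : i ≤ t
    · obtain ⟨b, hb⟩ := hH.ncard_quotSet_dvd_index hX i hi
      exact ⟨b, fun _ => by rw [hb, hh i hi]⟩
    · exact ⟨0, fun h => absurd h hi⟩
  choose k hk using hK
  have hrel : ∀ i < t,
      p ^ h i = p ^ h (i + 1) * (H (2 * i + 1)).relIndex (H (2 * (i + 1))) := by
    intro i hi
    rw [← hh i hi.le, ← hh (i + 1) hi]
    exact hH.ncard_quotSet_succ hi
  have hodd : ∀ i < t, (H (2 * i + 1)).index = p ^ h i * k (i + 1) := by
    intro i hi
    rw [← AddSubgroup.relIndex_mul_index (hH.le (2 * i + 1) (by omega)),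
      show 2 * i + 1 + 1 = 2 * (i + 1) by ring, hk (i + 1) hi, hrel i hi]
    ring
  have hzero : p ^ ℓ = p ^ h 0 * Nat.card (H 0) := by
    rw [← hcard, ← hh 0 (Nat.zero_le _)]
    exact hH.ncard_quotSet_zero
  have hlast : h t = 0 := by
    have h1 := hh t le_rfl
    rw [hH.ncard_quotSet_last hX] at h1
    exact (Nat.pow_eq_one.1 h1.symm).resolve_left hp.ne_one
  refine ⟨h, k, ?_⟩
  refine
    { zero := ?_, odd := ?_, even := ?_, k_zero := ?_, k_last := ?_, k_dvd := ?_,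
      h_last := hlast, h_lt := ?_, h_zero_aperiodic := ?_, h_zero_periodic := ?_ }
  · rw [← hk 0 (Nat.zero_le _)]
    exact eq_zmultiples_index (H 0)
  · intro i hi1 hit
    obtain ⟨j, rfl⟩ := Nat.exists_eq_add_of_le' hi1
    rw [Nat.add_sub_cancel, ← hodd j hit]
    exact eq_zmultiples_index (H (2 * j + 1))
  · intro i _ hit
    rw [← hk i hit]
    exact eq_zmultiples_index (H (2 * i))
  · have h1 := AddSubgroup.card_mul_index (H 0)
    rw [show (H 0).index = p ^ h 0 * k 0 from hk 0 (Nat.zero_le _), Nat.card_zmod] at h1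
    replace h1 := h1.trans (hn.trans (congrArg (· * m) hzero))
    refine Nat.eq_of_mul_eq_mul_left (hzero ▸ pow_pos hp.pos ℓ) (Eq.trans ?_ h1)
    ring
  · have h1 := hk t le_rfl
    rw [hH.top, AddSubgroup.index_top, hlast] at h1
    simpa using h1.symm
  · intro i hi1 hit
    obtain ⟨j, rfl⟩ := Nat.exists_eq_add_of_le' hi1
    rw [Nat.add_sub_cancel]
    have h1 := AddSubgroup.relIndex_mul_index (hH.le (2 * j) (by omega))
    rw [hodd j hit, hk j (by omega)] at h1
    refine ⟨(H (2 * j)).relIndex (H (2 * j + 1)),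
      Nat.eq_of_mul_eq_mul_left (pow_pos hp.pos (h j)) (h1.symm.trans ?_)⟩
    ring
  · intro i hi1 hit
    obtain ⟨j, rfl⟩ := Nat.exists_eq_add_of_le' hi1
    rw [Nat.add_sub_cancel]
    have hne : (H (2 * j + 1)).relIndex (H (2 * (j + 1))) ≠ 1 := fun h1 =>
      (hH.lt j hit).not_ge (AddSubgroup.relIndex_eq_one.1 h1)
    have hpos := pow_pos hp.pos (h j)
    have h1 := hrel j hit
    refine (Nat.pow_lt_pow_iff_right hp.one_lt).1 ?_
    have h0 : (H (2 * j + 1)).relIndex (H (2 * (j + 1))) ≠ 0 := by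
      intro h0; rw [h0] at h1; omega
    rw [h1]
    exact lt_mul_of_one_lt_right (pow_pos hp.pos _) (by omega)
  · intro hap
    rw [(isAperiodic_iff_card_eq_one hper).1 hap, mul_one] at hzero
    exact (Nat.pow_right_injective hp.two_le hzero).symm
  · intro hap
    rw [isAperiodic_iff_card_eq_one hper] at hap
    have hpos : 0 < Nat.card (H 0) := Nat.card_pos
    refine (Nat.pow_lt_pow_iff_right hp.one_lt).1 ?_
    rw [hzero]
    exact lt_mul_of_one_lt_right (pow_pos hp.pos _) (by omega)

/-- The `-1` in each factor `k i - 1` telescopes to `h (t - 1) - ℓ`; the last summand vanishes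
because `k t = 1`. -/
theorem codeExponent_eq {ℓ t : ℕ} {h k : ℕ → ℕ} (ht : 1 ≤ t) (hkt : k t = 1)
    (hk : ∀ i ≤ t, 1 ≤ k i) (h0 : h 0 ≤ ℓ) (hlt : ∀ i < t, h (i + 1) ≤ h i) :
    codeExponent ℓ t h k =
      (((ℓ - h 0) * (k 0 - 1) +
        ∑ i ∈ Finset.range t, (h i - h (i + 1)) * (k (i + 1) - 1) : ℕ) : ℤ) := by
  obtain ⟨s, rfl⟩ := Nat.exists_eq_add_of_le' ht
  have hsum : ((∑ i ∈ Finset.range s, (h i - h (i + 1)) * (k (i + 1) - 1) : ℕ) : ℤ) =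
      ∑ i ∈ Finset.range s, ((h i : ℤ) - h (i + 1)) * k (i + 1) - (h 0 - h s) := by
    rw [← Finset.sum_range_sub' (fun i => (h i : ℤ)), ← Finset.sum_sub_distrib, Nat.cast_sum]
    refine Finset.sum_congr rfl fun i hi => ?_
    have his := Finset.mem_range.1 hi
    rw [Nat.cast_mul, Nat.cast_sub (hlt i (by omega)), Nat.cast_sub (hk (i + 1) (by omega))]
    push_cast
    ring
  rw [codeExponent, Finset.sum_range_succ', Finset.sum_range_succ, hkt, Nat.sub_self, mul_zero,
    add_zero, Nat.cast_add, hsum, Nat.cast_mul, Nat.cast_sub h0, Nat.cast_sub (hk 0 (by omega))]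
  simp only [Nat.add_eq_zero_iff, one_ne_zero, and_false, if_false, if_true, Nat.add_sub_cancel,
    Nat.cast_one]
  ring

theorem pow_codeExponent_le [NeZero n] {p ℓ m t : ℕ} (hp : p.Prime) (hm : 1 ≤ m)
    (hn : n = p ^ ℓ * m) {X : Set (ZMod n)} (hcard : X.ncard = p ^ ℓ)
    {H : ℕ → AddSubgroup (ZMod n)} (hH : IsPyramidSeries X t H) {h k : ℕ → ℕ}
    (hhk : IsSeqPair p ℓ m X t H h k) :
    (p : ℝ) ^ codeExponent ℓ t h k ≤ (numTilingComplements X : ℝ) := by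
  have hX : X.Nonempty := by
    rw [← Set.ncard_pos, hcard]; exact pow_pos hp.pos ℓ
  have h0 : h 0 ≤ ℓ := by
    by_cases hap : IsAperiodic X
    · exact (hhk.h_zero_aperiodic hap).le
    · exact (hhk.h_zero_periodic hap).le
  have hlt : ∀ i < t, h (i + 1) ≤ h i := fun i hi => (hhk.h_lt (i + 1) (by omega) hi).le
  -- These bounds make each prescribed generator a divisor of `n`, hence equal to the index of its
  -- subgroup.
  have hdvd : ∀ i ≤ t, h i ≤ ℓ ∧ k i ∣ m := by
    intro i
    induction i with
    | zero => intro _; exact ⟨h0, hhk.k_zero ▸ dvd_rfl⟩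
    | succ i ih =>
      intro hi
      exact ⟨(hlt i hi).trans (ih (by omega)).1,
        (hhk.k_dvd (i + 1) (by omega) hi).trans (ih (by omega)).2⟩
  have hkpos : ∀ i ≤ t, 1 ≤ k i := fun i hi => Nat.pos_of_dvd_of_pos (hdvd i hi).2 hm
  have heven : ∀ i ≤ t, (H (2 * i)).index = p ^ h i * k i := by
    intro i hi
    have hgen : H (2 * i) = AddSubgroup.zmultiples ((p ^ h i * k i : ℕ) : ZMod n) := by
      rcases Nat.eq_zero_or_pos i with rfl | hpos
      · exact hhk.zero
      · exact hhk.even i hpos hi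
    rw [hgen, index_zmultiples_natCast]
    rw [hn]
    exact mul_dvd_mul (pow_dvd_pow p (hdvd i hi).1) (hdvd i hi).2
  have hodd : ∀ i < t, (H (2 * i + 1)).index = p ^ h i * k (i + 1) := by
    intro i hi
    have hgen : H (2 * i + 1) = AddSubgroup.zmultiples ((p ^ h i * k (i + 1) : ℕ) : ZMod n) :=
      hhk.odd (i + 1) (by omega) hi
    rw [hgen, index_zmultiples_natCast]
    rw [hn]
    exact mul_dvd_mul (pow_dvd_pow p (hdvd i hi.le).1) (hdvd (i + 1) hi).2
  have hrel : ∀ i < t,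
      (H (2 * i + 1)).relIndex (H (2 * (i + 1))) = p ^ (h i - h (i + 1)) := by
    intro i hi
    have h1 := AddSubgroup.relIndex_mul_index (hH.le (2 * i + 1) (by omega))
    rw [show 2 * i + 1 + 1 = 2 * (i + 1) by ring, hodd i hi, heven (i + 1) hi] at h1
    refine Nat.eq_of_mul_eq_mul_right
      (Nat.mul_pos (pow_pos hp.pos (h (i + 1))) (hkpos (i + 1) hi)) (h1.trans ?_)
    rw [← mul_assoc, ← pow_add, Nat.sub_add_cancel (hlt i hi)]
  have hcard0 : Nat.card (H 0) = p ^ (ℓ - h 0) := by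
    have h1 := AddSubgroup.card_mul_index (H 0)
    rw [show (H 0).index = p ^ h 0 * k 0 from heven 0 (Nat.zero_le _), Nat.card_zmod,
      hhk.k_zero] at h1
    replace h1 := h1.trans hn
    refine Nat.eq_of_mul_eq_mul_right (Nat.mul_pos (pow_pos hp.pos (h 0)) hm) (h1.trans ?_)
    rw [← mul_assoc, ← pow_add, Nat.sub_add_cancel h0]
  -- For an arbitrary pair of sequences, `h` is tied to the sizes by descending from `h t = 0`.
  have hN : ∀ i ≤ t, (quotSet X (H (2 * i))).ncard = p ^ h i := by
    intro i hi
    induction hi using Nat.decreasingInduction with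
    | self => rw [hH.ncard_quotSet_last hX, hhk.h_last, pow_zero]
    | of_succ i hi ih =>
      rw [hH.ncard_quotSet_succ hi, ih, hrel i hi, ← pow_add, Nat.add_sub_cancel' (hlt i hi)]
  have hmain := hH.prod_relIndex_le hX (k := k) fun i hi => by rw [hN i hi, heven i hi]
  rw [hcard0, Finset.prod_congr rfl fun i hi => by
      rw [hrel i (Finset.mem_range.1 hi), ← pow_mul],
    ← pow_mul, Finset.prod_pow_eq_pow_sum, ← pow_add] at hmain
  rw [codeExponent_eq hH.pos hhk.k_last hkpos h0 hlt, zpow_natCast]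
  exact_mod_cast hmain

end Cyclic

/-! ### Perfect codes as tiling complements. -/

section CayleyGraph

variable {G : Type*} [AddCommGroup G] {S : Set G}

theorem addCayley_adj_iff (hS0 : (0 : G) ∉ S) (hSneg : -S = S) {u v : G} :
    (SimpleGraph.addCayley S).Adj u v ↔ u - v ∈ S := by
  have hneg : ∀ x ∈ S, -x ∈ S := fun x hx => by rw [← hSneg]; simpa using hx
  rw [SimpleGraph.addCayley_adj']
  constructor
  · rintro ⟨-, g, hg, rfl | rfl⟩
    · simpa using hneg g hg
    · simpa using hg
  · intro h
    refine ⟨?_, u - v, h, Or.inr (by abel)⟩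
    rintro rfl
    exact hS0 (by simpa using h)

theorem isPerfectCode_addCayley_iff (hS0 : (0 : G) ∉ S) (hSneg : -S = S) {D : Set G} :
    IsPerfectCode (SimpleGraph.addCayley S) D ↔
      IsTilingComplement (extendedConnectionSet S) D := by
  have h : ∀ v d : G, (SimpleGraph.addCayley S).edist v d ≤ ((1 : ℕ) : ℕ∞) ↔
      v - d ∈ extendedConnectionSet S := by
    intro v d
    rw [Nat.cast_one, SimpleGraph.edist_le_one_iff_adj_or_eq, addCayley_adj_iff hS0 hSneg,
      extendedConnectionSet, Set.mem_union, Set.mem_singleton_iff, sub_eq_zero]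
  simp only [IsPerfectCode, IsPerfectECode, IsTilingComplement, h]

theorem numPerfectCodesContaining_addCayley (hS0 : (0 : G) ∉ S) (hSneg : -S = S) :
    numPerfectCodesContaining (SimpleGraph.addCayley S) 0 =
      numTilingComplements (extendedConnectionSet S) := by
  simp only [numPerfectCodesContaining, numTilingComplements,
    isPerfectCode_addCayley_iff hS0 hSneg]
  exact (Nat.card_coe_set_eq _).symm

theorem ncard_extendedConnectionSet [Finite G] (hS0 : (0 : G) ∉ S) (hSneg : -S = S)
    [(SimpleGraph.addCayley S).LocallyFinite] {d : ℕ}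
    (hdeg : (SimpleGraph.addCayley S).IsRegularOfDegree d) :
    (extendedConnectionSet S).ncard = d + 1 := by
  have hnbr : (SimpleGraph.addCayley S).neighborSet 0 = S := by
    ext v
    rw [SimpleGraph.mem_neighborSet, SimpleGraph.adj_comm, addCayley_adj_iff hS0 hSneg, sub_zero]
  have hcard : S.ncard = d := by
    rw [← hdeg 0, ← SimpleGraph.card_neighborSet_eq_degree, ← Nat.card_eq_fintype_card,
      Nat.card_coe_set_eq, hnbr]
  rw [extendedConnectionSet, Set.union_singleton, Set.ncard_insert_of_notMem hS0, hcard]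

end CayleyGraph

theorem theorem1p4 (p ℓ m n : ℕ) (hp : p.Prime) (hℓ : 1 ≤ ℓ) (hm : 2 ≤ m)
    (hn : n = p ^ ℓ * m)
    (S : Set (ZMod n)) (hS0 : (0 : ZMod n) ∉ S) (hSneg : -S = S)
    [(SimpleGraph.addCayley S).LocallyFinite]
    (hconn : (SimpleGraph.addCayley S).Connected)
    (hdeg : (SimpleGraph.addCayley S).IsRegularOfDegree (p ^ ℓ - 1))
    (hpyr : IsPyramidal (extendedConnectionSet S)) :
    (∃ (t : ℕ) (H : ℕ → AddSubgroup (ZMod n)),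
      IsLongestAdmissibleSeries (extendedConnectionSet S) t H) ∧
    ∀ (t : ℕ) (H : ℕ → AddSubgroup (ZMod n)),
      IsLongestAdmissibleSeries (extendedConnectionSet S) t H →
      (∃ h k : ℕ → ℕ, IsSeqPair p ℓ m (extendedConnectionSet S) t H h k) ∧
      ∀ h k : ℕ → ℕ, IsSeqPair p ℓ m (extendedConnectionSet S) t H h k →
        (p : ℝ) ^ codeExponent ℓ t h k ≤
          (numPerfectCodesContaining (SimpleGraph.addCayley S) (0 : ZMod n) : ℝ) := by
  have hpow : 0 < p ^ ℓ := pow_pos hp.pos ℓ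
  have : NeZero n := ⟨by rw [hn]; exact (Nat.mul_pos hpow (by omega)).ne'⟩
  have hcard : (extendedConnectionSet S).ncard = p ^ ℓ := by
    rw [ncard_extendedConnectionSet hS0 hSneg hdeg]
    omega
  refine ⟨exists_isLongestAdmissibleSeries hpyr, fun t H hH => ?_⟩
  have hser := hH.1.isPyramidSeries
  refine ⟨exists_isSeqPair hp hn hcard hH.1.period_eq hser, fun h k hhk => ?_⟩
  rw [numPerfectCodesContaining_addCayley hS0 hSneg]
  exact pow_codeExponent_le hp (by omega) hn hcard hser hhk
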